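/- Let $G$ be a group. A family of subgroups of $G$ is a set of subgroups of $G$ closed under conjugation and under taking subgroups. For a family $\mathfrak F$ of subgroups of $G$ and $S\le G$, let $\mathfrak F\cap S=\{H\cap S\mid H\in\mathfrak F\}$, a family of subgroups of $S$. The orbit category $\mathcal O_{\mathfrak F}G$ has as objects the $G$-sets $G/H$ with $H\in\mathfrak F$ and as morphisms the $G$-maps. Let $\mathrm{cd}_{\mathfrak F}(G)$ be the projective dimension of the constant functor $\underline{\mathbb Z}$ in the abelian category of contravariant functors $\mathcal O_{\mathfrak F}G\to\mathfrak{Ab}$. Equivalently, it is the least $n$ such that the Bredon cohomology $\mathrm H^i_{\mathfrak F}(G,M)=\mathrm{Ext}^i_{\mathfrak F}(\underline{\mathbb Z},M)$ vanishes for all $i>n$ and all $M$; it is $\infty$ if no such $n$ exists, and $-\infty$ if $\mathfrak F$ is empty. Let $\mathfrak F\subseteq\mathfrak G$ be families of subgroups of $G$, and suppose that there is an integer $d\ge 0$ such that $\mathrm{cd}_{\mathfrak F\cap H}(H)\le d$ for every $H\in\mathfrak G$. Then $$\mathrm{cd}_{\mathfrak F}(G)\le \mathrm{cd}_{\mathfrak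 G}(G)+d .$$ In particular, for every group $G$, if $\underline{\mathrm{cd}}(G)$ and $\underline{\underline{\mathrm{cd}}}(G)$ denote $\mathrm{cd}_{\mathfrak F}(G)$ for $\mathfrak F$ the family of finite subgroups and the family of virtually cyclic subgroups of $G$ respectively (a group being virtually cyclic if it has a cyclic subgroup of finite index, so that finite groups are included), then $$\underline{\mathrm{cd}}(G)\le\underline{\underline{\mathrm{cd}}}(G)+1 .$$ -/

import Mathlib

open CategoryTheory

universe u

/-- A family of subgroups of `G`: a collection of subgroups closed under conjugation and under
taking subgroups. -/
@[ext]
structure SubgroupFamily (G : Type u) [Group G] where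
  carrier : Set (Subgroup G)
  conj_mem : ∀ (g : G) (H : Subgroup G), H ∈ carrier →
    H.map (MulAut.conj g).toMonoidHom ∈ carrier
  mem_of_le : ∀ K H : Subgroup G, K ≤ H → H ∈ carrier → K ∈ carrier

namespace SubgroupFamily

variable {G : Type u} [Group G]

/-- The family `𝔉 ∩ S = {H ∩ S | H ∈ 𝔉}`, viewed as a family of subgroups of the group `S`. -/
def inter (F : SubgroupFamily G) (S : Subgroup G) : SubgroupFamily S where
  carrier := {L | ∃ H ∈ F.carrier, L = H.subgroupOf S}
  conj_mem := by
    rintro s _ ⟨H, hH, rfl⟩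
    refine ⟨_, F.conj_mem (s : G) H hH, ?_⟩
    ext x
    simp only [Subgroup.mem_map, Subgroup.mem_subgroupOf]
    constructor
    · rintro ⟨y, hy, rfl⟩
      exact ⟨y, hy, by simp⟩
    · rintro ⟨y, hy, hyx⟩
      have hy' : y = (((s⁻¹ * x * s : S)) : G) := by
        simp only [MulEquiv.coe_toMonoidHom, MulAut.conj_apply] at hyx
        simp [← hyx, mul_assoc]
      refine ⟨s⁻¹ * x * s, hy' ▸ hy, ?_⟩
      simp [mul_assoc]
  mem_of_le := by
    rintro K _ hK ⟨H, hH, rfl⟩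
    refine ⟨K.map S.subtype, F.mem_of_le _ H ?_ hH, ?_⟩
    · exact Subgroup.map_le_iff_le_comap.2 hK
    · exact (Subgroup.comap_map_eq_self_of_injective S.subtype_injective K).symm

/-- The orbit category `𝒪_𝔉 G`: its objects are the transitive `G`-sets `G ⧸ H` with `H ∈ 𝔉`. -/
structure Orbit (F : SubgroupFamily G) : Type u where
  stabilizer : Subgroup G
  mem : stabilizer ∈ F.carrier

/-- The morphisms of the orbit category are the `G`-maps `G ⧸ H → G ⧸ K`. -/
instance (F : SubgroupFamily G) : Category.{u} F.Orbit where
  Hom A B := (G ⧸ A.stabilizer) →[G] (G ⧸ B.stabilizer)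
  id A := MulActionHom.id G
  comp f g := g.comp f

/-- Right `𝒪_𝔉 G`-modules (Bredon modules): contravariant functors from the orbit category to
abelian groups. -/
abbrev BredonModule (F : SubgroupFamily G) : Type (u + 1) :=
  F.Orbitᵒᵖ ⥤ AddCommGrpCat.{u}

/-- The trivial Bredon module, constant with value `ℤ`. -/
def trivialModule (F : SubgroupFamily G) : F.BredonModule :=
  (Functor.const _).obj (AddCommGrpCat.of (ULift.{u} ℤ))

/-- The Bredon cohomological dimension `cd_𝔉(G)`: the projective dimension of the trivial module
in the abelian category of Bredon modules, i.e. the least `n` such that the Bredon cohomology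
`H^i_𝔉(G, M) = Ext^i(ℤ, M)` vanishes for all `i > n` and all `M`. It is `⊤` if there is no
such `n`, and it is `⊥` exactly when the family is empty. -/
noncomputable def cd (F : SubgroupFamily G) : WithBot ℕ∞ :=
  projectiveDimension F.trivialModule

end SubgroupFamily

/-- A group is virtually cyclic if it has a cyclic subgroup of finite index. In particular
finite groups are virtually cyclic. -/
def IsVirtuallyCyclic (G : Type u) [Group G] : Prop :=
  ∃ C : Subgroup G, IsCyclic C ∧ C.FiniteIndex

theorem IsVirtuallyCyclic.of_injective {G H : Type u} [Group G] [Group H]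
    (hH : IsVirtuallyCyclic H) (f : G →* H) (hf : Function.Injective f) :
    IsVirtuallyCyclic G := by
  obtain ⟨C, hC, hC'⟩ := hH
  refine ⟨C.comap f, ?_, ⟨?_⟩⟩
  swap
  · rw [Subgroup.index_comap]
    exact fun h => hC'.index_ne_zero (Subgroup.index_eq_zero_of_relIndex_eq_zero h)
  refine isCyclic_of_injective (f.subgroupComap C) fun x y h => ?_
  exact Subtype.ext (hf (congrArg Subtype.val h))

/-- A conjugate of `H` is isomorphic to `H`. -/
noncomputable def Subgroup.conjMulEquiv {G : Type u} [Group G] (g : G) (H : Subgroup G) :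
    H ≃* H.map (MulAut.conj g).toMonoidHom :=
  H.equivMapOfInjective _ (MulAut.conj g).injective

/-- The family of finite subgroups of `G`. -/
def finiteFamily (G : Type u) [Group G] : SubgroupFamily G where
  carrier := {H | Finite H}
  conj_mem := fun g H (_ : Finite H) => Finite.of_equiv H (H.conjMulEquiv g).toEquiv
  mem_of_le := fun _ H hKH (_ : Finite H) =>
    Finite.of_injective (Subgroup.inclusion hKH) (Subgroup.inclusion_injective hKH)

/-- The family of virtually cyclic subgroups of `G`. -/
def virtuallyCyclicFamily (G : Type u) [Group G] : SubgroupFamily G where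
  carrier := {H | IsVirtuallyCyclic H}
  conj_mem := fun g H (hH : IsVirtuallyCyclic H) =>
    hH.of_injective (H.conjMulEquiv g).symm.toMonoidHom (H.conjMulEquiv g).symm.injective
  mem_of_le := fun _ H hKH (hH : IsVirtuallyCyclic H) =>
    hH.of_injective (Subgroup.inclusion hKH) (Subgroup.inclusion_injective hKH)

/-! Restriction along the inclusion of the smaller orbit category into the larger one is exact and
carries the constant module to the constant module. Such a functor adds at most `d` to projective
dimensions once every object is covered by a projective whose image has dimension at most `d`; this
is dimension shifting (`hasProjectiveDimensionLT_obj_of_presentations`). By Yoneda, sums of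
permutation modules `ℤ[G/K]`, with `K` in the larger family, cover every module, so it remains to
bound the dimension of `ℤ[G/K]` over the smaller family.

That module is induced. The `𝔉`-orbits over `G/K` form a category equivalent to the orbit category
of `K` for `𝔉 ∩ K` (`orbitsOverQuotient`), and `ℤ[G/K]` is the left Kan extension of the constant
module along the functor forgetting the map to `G/K`. This extension is a direct sum over fibres,
hence exact, and is left adjoint to an exact functor, hence preserves projectives. So the dimension
of `ℤ[G/K]` is at most that of the trivial module of `K`
(`hasProjectiveDimensionLT_freeModule_quotient`).

For the second inequality, a virtually cyclic group must have dimension at most one for its finite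
subgroups. A finite group acts on a point. An infinite one acts on the line through a sign and a
cocycle obtained by transfer, with finite stabilizers, and every finite subgroup fixes the whole
line or a single vertex; the cellular chains then resolve `ℤ` in length one (`cd_le_one_of_tree`).
-/

open Limits

/-! ### Dimension shifting along exact functors. -/

section Generic

universe v v' w w'

variable {A : Type w} [Category.{v} A] [Abelian A] {B : Type w'} [Category.{v'} B] [Abelian B]

/-- If `Φ` is exact and every object is a quotient of a projective whose image has projective
dimension at most `d`, then `Φ` raises projective dimensions by at most `d`. -/
theorem hasProjectiveDimensionLT_obj_of_presentations (Φ : A ⥤ B) [Φ.PreservesZeroMorphisms]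
    (hΦ : ∀ S : ShortComplex A, S.ShortExact → (S.map Φ).ShortExact) (d : ℕ)
    (hP : ∀ X : A, ∃ (P : A) (p : P ⟶ X), Projective P ∧ Epi p ∧
      HasProjectiveDimensionLT (Φ.obj P) (d + 1)) (n : ℕ) :
    ∀ X : A, HasProjectiveDimensionLT X n → HasProjectiveDimensionLT (Φ.obj X) (n + d) := by
  induction n with
  | zero =>
    intro X hX
    have : HasProjectiveDimensionLT (Φ.obj X) 0 :=
      (Φ.map_isZero (isZero_of_hasProjectiveDimensionLT_zero X)).hasProjectiveDimensionLT_zero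
    infer_instance
  | succ k ih =>
    intro X hX
    obtain ⟨P, p, _, _, hd⟩ := hP X
    rcases k with _ | k
    -- The kernel of a cover of a projective need not vanish, so the induction cannot descend here;
    -- a splitting of the cover is used instead.
    · have : Projective X := (projective_iff_hasProjectiveDimensionLT_one).2 hX
      have r : Retract X P := ⟨Projective.factorThru (𝟙 X) p, p, by simp⟩
      have := (r.map Φ).hasProjectiveDimensionLT (d + 1)
      rwa [zero_add, add_comm]
    · have hS : (ShortComplex.mk (kernel.ι p) p (kernel.condition p)).ShortExact :=
        { exact := ShortComplex.exact_kernel p }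
      have h₁ := ih _ ((hS.hasProjectiveDimensionLT_X₃_iff k inferInstance).1 hX)
      have h₂ : HasProjectiveDimensionLT (Φ.obj P) (k + 1 + d + 1) :=
        hasProjectiveDimensionLT_of_ge _ (d + 1) _ (by omega)
      have := (hΦ _ hS).hasProjectiveDimensionLT_X₃ (k + 1 + d) h₁ h₂
      rw [show k + 1 + 1 + d = k + 1 + d + 1 by omega]
      exact this

theorem hasProjectiveDimensionLT_obj_of_preservesProjectives [EnoughProjectives A] (Φ : A ⥤ B)
    [Φ.PreservesZeroMorphisms]
    (hΦ : ∀ S : ShortComplex A, S.ShortExact → (S.map Φ).ShortExact)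
    (hP : ∀ P : A, Projective P → Projective (Φ.obj P)) (n : ℕ) (X : A)
    (hX : HasProjectiveDimensionLT X n) : HasProjectiveDimensionLT (Φ.obj X) n :=
  hasProjectiveDimensionLT_obj_of_presentations Φ hΦ 0
    (fun X => ⟨Projective.over X, Projective.π X, inferInstance, inferInstance,
      have := hP (Projective.over X) inferInstance
      inferInstance⟩) n X hX

end Generic

/-! ### Objectwise exactness in module categories. -/

section FunctorCategory

variable {D : Type u} [Category.{u} D]

theorem shortExact_iff_evaluation (S : ShortComplex (D ⥤ AddCommGrpCat.{u})) :
    S.ShortExact ↔ ∀ d, Function.Injective (S.f.app d) ∧ Function.Surjective (S.g.app d) ∧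
      Function.Exact (S.f.app d) (S.g.app d) := by
  constructor
  · intro h d
    have h' := h.map_of_exact ((evaluation D AddCommGrpCat.{u}).obj d)
    exact ⟨h'.ab_injective_f, h'.ab_surjective_g,
      (ShortComplex.ab_exact_iff_function_exact _).1 h'.exact⟩
  · intro h
    refine ShortComplex.ShortExact.mk' ?_ ?_ ?_
    · rw [ShortComplex.exact_iff_isZero_homology]
      refine Functor.isZero _ fun d => ?_
      have e := S.mapHomologyIso ((evaluation D AddCommGrpCat.{u}).obj d)
      refine IsZero.of_iso ?_ e.symm
      rw [← ShortComplex.exact_iff_isZero_homology, ShortComplex.ab_exact_iff_function_exact]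
      exact (h d).2.2
    · have : ∀ d, Mono (S.f.app d) := fun d => (AddCommGrpCat.mono_iff_injective _).2 (h d).1
      exact NatTrans.mono_of_mono_app _
    · have : ∀ d, Epi (S.g.app d) := fun d => (AddCommGrpCat.epi_iff_surjective _).2 (h d).2.1
      exact NatTrans.epi_of_epi_app _

theorem epi_iff_surjective_app {M N : D ⥤ AddCommGrpCat.{u}} (f : M ⟶ N) :
    Epi f ↔ ∀ d, Function.Surjective (f.app d) := by
  rw [NatTrans.epi_iff_epi_app]
  simp only [AddCommGrpCat.epi_iff_surjective]

/-- Precomposition with a functor, on categories of modules. -/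
abbrev restriction {E : Type u} [Category.{u} E] (φ : E ⥤ D) :
    (D ⥤ AddCommGrpCat.{u}) ⥤ (E ⥤ AddCommGrpCat.{u}) :=
  (Functor.whiskeringLeft _ _ _).obj φ

instance {E : Type u} [Category.{u} E] (φ : E ⥤ D) : (restriction φ).Additive where

theorem shortExact_restriction {E : Type u} [Category.{u} E] (φ : E ⥤ D)
    (S : ShortComplex (D ⥤ AddCommGrpCat.{u})) (hS : S.ShortExact) :
    (S.map (restriction φ)).ShortExact := by
  rw [shortExact_iff_evaluation] at hS ⊢
  exact fun e => hS (φ.obj e)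

end FunctorCategory

/-! ### Direct sums of modules. -/

section DirectSum

open scoped DirectSum Classical

variable {D : Type u} [Category.{u} D]

theorem directSum_map_exact {ι : Type*} {α β γ : ι → Type*} [∀ i, AddCommGroup (α i)]
    [∀ i, AddCommGroup (β i)] [∀ i, AddCommGroup (γ i)] (f : ∀ i, α i →+ β i) (g : ∀ i, β i →+ γ i)
    (h : ∀ i, Function.Exact (f i) (g i)) :
    Function.Exact (DirectSum.map f) (DirectSum.map g) := by
  intro y
  constructor
  · intro hy
    have hy' : ∀ i, ∃ x, f i x = y i := fun i => (h i (y i)).1 (by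
      rw [← DirectSum.map_apply, hy]; rfl)
    choose x hx using hy'
    -- Cutting the chosen preimages off outside the support of `y` keeps the family finitely
    -- supported.
    refine ⟨DirectSum.mk _ y.support fun i => x i, ?_⟩
    ext i
    rw [DirectSum.map_apply]
    by_cases hi : i ∈ y.support
    · rw [DirectSum.mk_apply_of_mem hi, hx]
    · rw [DirectSum.mk_apply_of_notMem hi, map_zero]
      simpa using (DFinsupp.notMem_support_iff.1 hi).symm
  · rintro ⟨x, rfl⟩
    ext i
    rw [DirectSum.map_apply, DirectSum.map_apply]
    exact (h i _).2 ⟨_, rfl⟩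

/-- The direct sum of a family of modules over a category. -/
noncomputable def moduleSum {ι : Type u} (M : ι → D ⥤ AddCommGrpCat.{u}) :
    D ⥤ AddCommGrpCat.{u} where
  obj d := AddCommGrpCat.of (⨁ i, (M i).obj d)
  map f := AddCommGrpCat.ofHom (DirectSum.map fun i => ((M i).map f).hom)
  map_id d := by
    ext x
    simp
  map_comp f g := by
    ext x
    simp [← DirectSum.map_comp]

/-- The map out of a direct sum of modules given by a family of maps. -/
noncomputable def moduleSumDesc {ι : Type u} {M : ι → D ⥤ AddCommGrpCat.{u}}
    {N : D ⥤ AddCommGrpCat.{u}} (f : ∀ i, M i ⟶ N) : moduleSum M ⟶ N where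
  app d := AddCommGrpCat.ofHom (DirectSum.toAddMonoid fun i => ((f i).app d).hom)
  naturality d e g := by
    refine AddCommGrpCat.hom_ext (DirectSum.addHom_ext fun i x => ?_)
    simp [moduleSum]

/-- The inclusion of a summand. -/
noncomputable def moduleSumι {ι : Type u} (M : ι → D ⥤ AddCommGrpCat.{u}) (i : ι) :
    M i ⟶ moduleSum M where
  app d := AddCommGrpCat.ofHom (DirectSum.of (fun i => (M i).obj d) i)
  naturality d e g := by
    ext x
    exact (DirectSum.map_of (fun i => ((M i).map g).hom) i x).symm

/-- The direct sum of a family of maps of modules. -/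
noncomputable def moduleSumMap {ι : Type u} {M N : ι → D ⥤ AddCommGrpCat.{u}}
    (f : ∀ i, M i ⟶ N i) : moduleSum M ⟶ moduleSum N where
  app d := AddCommGrpCat.ofHom (DirectSum.map fun i => ((f i).app d).hom)
  naturality d e g := by
    ext x
    exact DirectSum.ext fun i => congr(($((f i).naturality g)) (DFunLike.coe (F := ⨁ i, (M i).obj d) x i))

@[ext]
theorem moduleSum_hom_ext {ι : Type u} {M : ι → D ⥤ AddCommGrpCat.{u}}
    {N : D ⥤ AddCommGrpCat.{u}} {f g : moduleSum M ⟶ N}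
    (h : ∀ i, moduleSumι M i ≫ f = moduleSumι M i ≫ g) : f = g := by
  ext1
  ext1 d
  refine AddCommGrpCat.hom_ext (DirectSum.addHom_ext fun i x => ?_)
  exact congr(($(h i)).app d x)

@[simp]
theorem moduleSumι_desc {ι : Type u} {M : ι → D ⥤ AddCommGrpCat.{u}}
    {N : D ⥤ AddCommGrpCat.{u}} (f : ∀ i, M i ⟶ N) (i : ι) :
    moduleSumι M i ≫ moduleSumDesc f = f i := by
  ext d x
  exact DirectSum.toAddMonoid_of (fun i => ((f i).app d).hom) i x

theorem projective_moduleSum {ι : Type u} (M : ι → D ⥤ AddCommGrpCat.{u})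
    (h : ∀ i, Projective (M i)) : Projective (moduleSum M) where
  factors f e _ := ⟨moduleSumDesc fun i => Projective.factorThru (moduleSumι M i ≫ f) e, by
    ext1 i
    rw [← Category.assoc, moduleSumι_desc, Projective.factorThru_comp]⟩

/-- Direct sums of modules are exact. -/
theorem shortExact_moduleSum {ι : Type u} (S : ι → ShortComplex (D ⥤ AddCommGrpCat.{u}))
    (hS : ∀ i, (S i).ShortExact) :
    ∃ w, (ShortComplex.mk (moduleSumMap fun i => (S i).f) (moduleSumMap fun i => (S i).g)
      w).ShortExact := by
  simp only [shortExact_iff_evaluation] at hS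
  refine ⟨?_, ?_⟩
  · refine NatTrans.ext (funext fun d => AddCommGrpCat.hom_ext (AddMonoidHom.ext fun x =>
      DirectSum.ext fun i => ?_))
    exact (hS i d).2.2.apply_apply_eq_zero (DFunLike.coe (F := ⨁ i, (S i).X₁.obj d) x i)
  · rw [shortExact_iff_evaluation]
    exact fun d => ⟨(DirectSum.map_injective _).2 fun i => (hS i d).1,
      (DirectSum.map_surjective _).2 fun i => (hS i d).2.1,
      directSum_map_exact _ _ fun i => (hS i d).2.2⟩

theorem epi_moduleSumDesc {ι : Type u} {M : ι → D ⥤ AddCommGrpCat.{u}}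
    {N : D ⥤ AddCommGrpCat.{u}} (f : ∀ i, M i ⟶ N)
    (h : ∀ (d : D) (x : N.obj d), ∃ i y, (f i).app d y = x) : Epi (moduleSumDesc f) := by
  rw [epi_iff_surjective_app]
  intro d x
  obtain ⟨i, y, rfl⟩ := h d x
  exact ⟨(moduleSumι M i).app d y, congr(($(moduleSumι_desc f i)).app d y)⟩

/-- Summing projective presentations of the summands presents the sum, and its kernel is the sum of
the kernels, so dimension shifting applies to all summands at once. -/
theorem hasProjectiveDimensionLT_moduleSum [EnoughProjectives (D ⥤ AddCommGrpCat.{u})]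
    {ι : Type u} (n : ℕ) : ∀ M : ι → D ⥤ AddCommGrpCat.{u},
    (∀ i, HasProjectiveDimensionLT (M i) n) → HasProjectiveDimensionLT (moduleSum M) n := by
  induction n with
  | zero =>
    intro M hM
    refine IsZero.hasProjectiveDimensionLT_zero ((IsZero.iff_id_eq_zero _).2 ?_)
    ext1 i
    exact (isZero_of_hasProjectiveDimensionLT_zero (M i)).eq_of_src _ _
  | succ k ih =>
    intro M hM
    rcases k with _ | k
    · have := projective_moduleSum M fun i =>
        (projective_iff_hasProjectiveDimensionLT_one).2 (hM i)
      infer_instance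
    · obtain ⟨w, hw⟩ := shortExact_moduleSum
        (fun i => ShortComplex.mk (kernel.ι (Projective.π (M i))) (Projective.π (M i))
          (kernel.condition _)) fun i => { exact := ShortComplex.exact_kernel _ }
      have h₂ : Projective (moduleSum fun i => Projective.over (M i)) :=
        projective_moduleSum _ fun i => inferInstance
      refine (hw.hasProjectiveDimensionLT_X₃_iff k h₂).2 (ih _ fun i => ?_)
      have hS : (ShortComplex.mk (kernel.ι (Projective.π (M i))) (Projective.π (M i))
        (kernel.condition _)).ShortExact := { exact := ShortComplex.exact_kernel _ }
      exact (hS.hasProjectiveDimensionLT_X₃_iff k inferInstance).1 (hM i)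

end DirectSum

/-! ### The constant module. -/

section Constant

variable {J : Type u} [Category.{u} J]

/-- The constant module `ℤ` over a category. -/
abbrev constantModule (J : Type u) [Category.{u} J] : J ⥤ AddCommGrpCat.{u} :=
  (Functor.const _).obj (AddCommGrpCat.of (ULift.{u} ℤ))

/-- The map out of the constant module given by a compatible family of elements. -/
def constantModuleDesc {M : J ⥤ AddCommGrpCat.{u}} (m : ∀ j, M.obj j)
    (hm : ∀ {j k : J} (φ : j ⟶ k), M.map φ (m j) = m k) : constantModule J ⟶ M where
  app j := AddCommGrpCat.ofHom
    ((zmultiplesHom (M.obj j) (m j)).comp AddEquiv.ulift.toAddMonoidHom)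
  naturality j k φ := by
    ext ⟨n⟩
    change n • m k = M.map φ (n • m j)
    rw [map_zsmul, hm]

theorem addMonoidHom_ulift_int_ext {A : Type*} [AddMonoid A] {f g : ULift.{u} ℤ →+ A}
    (h : f ⟨1⟩ = g ⟨1⟩) : f = g := by
  have : f.comp AddEquiv.ulift.symm.toAddMonoidHom = g.comp AddEquiv.ulift.symm.toAddMonoidHom :=
    AddMonoidHom.ext_int h
  ext ⟨n⟩
  exact congr($this n)

theorem constantModule_hom_ext {M : J ⥤ AddCommGrpCat.{u}} {f g : constantModule J ⟶ M}
    (h : ∀ j, f.app j ⟨1⟩ = g.app j ⟨1⟩) : f = g := by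
  refine NatTrans.ext (funext fun j => AddCommGrpCat.hom_ext ?_)
  exact addMonoidHom_ulift_int_ext (h j)

theorem constantModule_map_app_one {M : J ⥤ AddCommGrpCat.{u}} (f : constantModule J ⟶ M)
    {j k : J} (φ : j ⟶ k) : M.map φ (f.app j ⟨1⟩) = f.app k ⟨1⟩ :=
  congr($(f.naturality φ) ⟨1⟩).symm

/-- If every object receives exactly one morphism from exactly one member of a family of
objects, then the constant module is projective. -/
theorem projective_constantModule {I : Type*} (s : I → J)
    (h : ∀ j, Nonempty (Unique (Σ i, (s i ⟶ j)))) : Projective (constantModule J) where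
  factors {N M} f e he := by
    rw [epi_iff_surjective_app] at he
    -- A lift may be chosen freely at the objects `s i`; its value elsewhere is transported along
    -- the unique incoming arrow.
    choose m hm using fun i => he (s i) (f.app (s i) ⟨1⟩)
    let p (j : J) : Σ i, (s i ⟶ j) := (h j).some.default
    have hp (j : J) (q : Σ i, (s i ⟶ j)) : p j = q := ((h j).some.uniq q).symm
    refine ⟨constantModuleDesc (fun j => N.map (p j).2 (m (p j).1)) ?_, ?_⟩
    · intro j k φ
      rw [hp k ⟨(p j).1, (p j).2 ≫ φ⟩]
      simp
    · refine constantModule_hom_ext fun j => ?_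
      change e.app j ((1 : ℤ) • N.map (p j).2 (m (p j).1)) = _
      rw [one_zsmul, NatTrans.naturality_apply, hm]
      exact constantModule_map_app_one f _

end Constant

/-! ### Induction from categories of elements, and free modules. -/

section Elements

open scoped DirectSum Classical

variable {D : Type u} [Category.{u} D] (X : D ⥤ Type u)

/-- The action of a morphism on the direct sums forming an induced module. -/
noncomputable def inducedModuleMap (N : X.Elements ⥤ AddCommGrpCat.{u}) {d e : D} (f : d ⟶ e) :
    (⨁ x : X.obj d, N.obj ⟨d, x⟩) →+ ⨁ y : X.obj e, N.obj ⟨e, y⟩ :=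
  DirectSum.toAddMonoid fun x =>
    (DirectSum.of (fun y : X.obj e => N.obj ⟨e, y⟩) (X.map f x)).comp
      (N.map (X := ⟨d, x⟩) (Y := ⟨e, X.map f x⟩) ⟨f, rfl⟩).hom

theorem inducedModuleMap_of (N : X.Elements ⥤ AddCommGrpCat.{u}) {d e : D} {x : X.obj d}
    {y : X.obj e} (f : d ⟶ e) (hf : X.map f x = y) (n : N.obj ⟨d, x⟩) :
    inducedModuleMap X N f (DirectSum.of (fun x : X.obj d => N.obj ⟨d, x⟩) x n) =
      DirectSum.of (fun y : X.obj e => N.obj ⟨e, y⟩) y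
        (N.map (X := ⟨d, x⟩) (Y := ⟨e, y⟩) ⟨f, hf⟩ n) := by
  subst hf
  exact DirectSum.toAddMonoid_of _ _ _

/-- The left Kan extension of a module along the discrete fibration of elements of `X`. -/
noncomputable def inducedModule (N : X.Elements ⥤ AddCommGrpCat.{u}) :
    D ⥤ AddCommGrpCat.{u} where
  obj d := AddCommGrpCat.of (⨁ x : X.obj d, N.obj ⟨d, x⟩)
  map f := AddCommGrpCat.ofHom (inducedModuleMap X N f)
  map_id d := by
    refine AddCommGrpCat.hom_ext (DirectSum.addHom_ext fun x n => ?_)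
    refine (inducedModuleMap_of X N (y := x) (𝟙 d) (by simp) n).trans ?_
    exact congrArg (DirectSum.of (fun x : X.obj d => N.obj ⟨d, x⟩) x)
      congr($(N.map_id ⟨d, x⟩) n)
  map_comp {a b c} f g := by
    refine AddCommGrpCat.hom_ext (DirectSum.addHom_ext fun x n => ?_)
    let φ : X.elementsMk a x ⟶ X.elementsMk b (X.map f x) := ⟨f, rfl⟩
    let ψ : X.elementsMk b (X.map f x) ⟶ X.elementsMk c (X.map g (X.map f x)) := ⟨g, rfl⟩
    refine (inducedModuleMap_of X N (f ≫ g) (φ ≫ ψ).2 n).trans ?_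
    refine Eq.trans ?_ ((congrArg (inducedModuleMap X N g)
      (inducedModuleMap_of X N f rfl n)).trans (inducedModuleMap_of X N g rfl _)).symm
    exact congrArg (DirectSum.of (fun x : X.obj c => N.obj ⟨c, x⟩) _)
      congr($(N.map_comp φ ψ) n)

/-- The unit of the induction adjunction. -/
noncomputable def inducedModuleUnit (N : X.Elements ⥤ AddCommGrpCat.{u}) :
    N ⟶ CategoryOfElements.π X ⋙ inducedModule X N where
  app j := AddCommGrpCat.ofHom (DirectSum.of (fun x : X.obj j.1 => N.obj ⟨j.1, x⟩) j.2)
  naturality j k φ := by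
    ext n
    exact (inducedModuleMap_of X N φ.1 φ.2 n).symm

variable {X}

theorem inducedModule_hom_ext {N : X.Elements ⥤ AddCommGrpCat.{u}} {M : D ⥤ AddCommGrpCat.{u}}
    {f g : inducedModule X N ⟶ M}
    (h : ∀ j n, f.app j.1 ((inducedModuleUnit X N).app j n) =
      g.app j.1 ((inducedModuleUnit X N).app j n)) : f = g := by
  refine NatTrans.ext (funext fun d => AddCommGrpCat.hom_ext (DirectSum.addHom_ext fun x n => ?_))
  exact h ⟨d, x⟩ n

/-- The map out of an induced module adjoint to a given map. -/
noncomputable def inducedModuleDesc {N : X.Elements ⥤ AddCommGrpCat.{u}}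
    {M : D ⥤ AddCommGrpCat.{u}} (f : N ⟶ CategoryOfElements.π X ⋙ M) :
    inducedModule X N ⟶ M where
  app d := AddCommGrpCat.ofHom (DirectSum.toAddMonoid fun x => (f.app ⟨d, x⟩).hom)
  naturality d e g := by
    refine AddCommGrpCat.hom_ext (DirectSum.addHom_ext fun x n => ?_)
    have h := (congrArg (DirectSum.toAddMonoid (γ := M.obj e) fun x => (f.app ⟨e, x⟩).hom)
      (inducedModuleMap_of X N g rfl n)).trans (DirectSum.toAddMonoid_of _ _ _)
    refine h.trans (Eq.trans ?_ (congrArg (M.map g)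
      (DirectSum.toAddMonoid_of (γ := M.obj d) (fun x => (f.app ⟨d, x⟩).hom) x n).symm))
    exact congr($(f.naturality (X := ⟨d, x⟩) (Y := ⟨e, X.map g x⟩) ⟨g, rfl⟩) n)

theorem inducedModuleDesc_app {N : X.Elements ⥤ AddCommGrpCat.{u}}
    {M : D ⥤ AddCommGrpCat.{u}} (f : N ⟶ CategoryOfElements.π X ⋙ M) (j : X.Elements)
    (n : N.obj j) :
    (inducedModuleDesc f).app j.1 ((inducedModuleUnit X N).app j n) = f.app j n :=
  DirectSum.toAddMonoid_of _ _ _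

/-- Induction is left adjoint to restriction along the projection, and restriction preserves
epimorphisms. -/
theorem projective_inducedModule (N : X.Elements ⥤ AddCommGrpCat.{u}) (hN : Projective N) :
    Projective (inducedModule X N) where
  factors {M' M} f e he := by
    have : Epi (Functor.whiskerLeft (CategoryOfElements.π X) e) := by
      rw [epi_iff_surjective_app] at he ⊢
      exact fun j => he j.1
    refine ⟨inducedModuleDesc (Projective.factorThru
      (inducedModuleUnit X N ≫ Functor.whiskerLeft (CategoryOfElements.π X) f)
      (Functor.whiskerLeft (CategoryOfElements.π X) e)), inducedModule_hom_ext fun j n => ?_⟩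
    refine (congrArg (e.app j.1) (inducedModuleDesc_app _ j n)).trans ?_
    exact congr(($(Projective.factorThru_comp
      (inducedModuleUnit X N ≫ Functor.whiskerLeft (CategoryOfElements.π X) f)
      (Functor.whiskerLeft (CategoryOfElements.π X) e))).app j n)

variable (X) in
/-- Induction along the projection from the category of elements, as a functor. -/
noncomputable def inducedModuleFunctor :
    (X.Elements ⥤ AddCommGrpCat.{u}) ⥤ (D ⥤ AddCommGrpCat.{u}) where
  obj N := inducedModule X N
  map {N N'} f :=
    { app := fun d => AddCommGrpCat.ofHom (DirectSum.map fun x => (f.app ⟨d, x⟩).hom)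
      naturality := fun d e g => by
        refine AddCommGrpCat.hom_ext (DirectSum.addHom_ext fun x n => ?_)
        have h := (congrArg (DirectSum.map fun x => (f.app ⟨e, x⟩).hom)
          (inducedModuleMap_of X N g rfl n)).trans (DirectSum.map_of _ _ _)
        have h' := (congrArg (inducedModuleMap X N' g)
          (DirectSum.map_of (fun y => (f.app ⟨d, y⟩).hom) x n)).trans
          (inducedModuleMap_of X N' g rfl _)
        refine h.trans (Eq.trans ?_ h'.symm)
        exact congrArg (DirectSum.of (fun y : X.obj e => N'.obj ⟨e, y⟩) _)
          congr($(f.naturality (X := ⟨d, x⟩) (Y := ⟨e, X.map g x⟩) ⟨g, rfl⟩) n) }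
  map_id _ := NatTrans.ext (funext fun _ => AddCommGrpCat.hom_ext
    (AddMonoidHom.ext fun _ => DirectSum.ext fun _ => rfl))
  map_comp _ _ := NatTrans.ext (funext fun _ => AddCommGrpCat.hom_ext
    (AddMonoidHom.ext fun _ => DirectSum.ext fun _ => rfl))

instance : (inducedModuleFunctor X).PreservesZeroMorphisms where
  map_zero _ _ := NatTrans.ext (funext fun _ => AddCommGrpCat.hom_ext
    (AddMonoidHom.ext fun _ => DirectSum.ext fun _ => rfl))

theorem shortExact_inducedModuleFunctor (S : ShortComplex (X.Elements ⥤ AddCommGrpCat.{u}))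
    (hS : S.ShortExact) : (S.map (inducedModuleFunctor X)).ShortExact := by
  rw [shortExact_iff_evaluation] at hS ⊢
  exact fun d => ⟨(DirectSum.map_injective _).2 fun x => (hS ⟨d, x⟩).1,
    (DirectSum.map_surjective _).2 fun x => (hS ⟨d, x⟩).2.1,
    directSum_map_exact _ _ fun x => (hS ⟨d, x⟩).2.2⟩

variable (X) in
/-- The free module `ℤ[X]` on a functor to sets. -/
noncomputable abbrev freeModule : D ⥤ AddCommGrpCat.{u} := inducedModule X (constantModule _)

variable (X) in
/-- The basis element of `ℤ[X]` given by an element of `X`. -/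
noncomputable def freeModuleBasis {d : D} (x : X.obj d) : (freeModule X).obj d :=
  (inducedModuleUnit X (constantModule _)).app ⟨d, x⟩ ⟨1⟩

theorem freeModule_map_basis {d e : D} (f : d ⟶ e) (x : X.obj d) :
    (freeModule X).map f (freeModuleBasis X x) = freeModuleBasis X (X.map f x) :=
  inducedModuleMap_of X (constantModule _) f rfl _

theorem freeModule_addHom_ext {d : D} {A : Type*} [AddCommGroup A]
    {f g : (freeModule X).obj d →+ A}
    (h : ∀ x, f (freeModuleBasis X x) = g (freeModuleBasis X x)) : f = g := by
  refine DirectSum.addHom_ext' fun x => addMonoidHom_ulift_int_ext ?_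
  exact h x

/-- The additive map out of `ℤ[X]` at an object with prescribed values on the basis. -/
noncomputable def freeModuleLift {d : D} {A : Type*} [AddCommGroup A] (v : X.obj d → A) :
    (freeModule X).obj d →+ A :=
  DirectSum.toAddMonoid fun x => (zmultiplesHom A (v x)).comp AddEquiv.ulift.toAddMonoidHom

theorem freeModuleLift_basis {d : D} {A : Type*} [AddCommGroup A] (v : X.obj d → A)
    (x : X.obj d) : freeModuleLift v (freeModuleBasis X x) = v x :=
  (DirectSum.toAddMonoid_of _ _ _).trans (one_zsmul _)

/-- The map out of `ℤ[X]` given by a natural family of elements. -/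
noncomputable def freeModuleDesc {M : D ⥤ AddCommGrpCat.{u}} (v : ∀ d, X.obj d → M.obj d)
    (hv : ∀ {d e : D} (f : d ⟶ e) (x : X.obj d), M.map f (v d x) = v e (X.map f x)) :
    freeModule X ⟶ M where
  app d := AddCommGrpCat.ofHom (freeModuleLift (v d))
  naturality d e f := by
    refine AddCommGrpCat.hom_ext (freeModule_addHom_ext fun x => ?_)
    change freeModuleLift (v e) ((freeModule X).map f (freeModuleBasis X x)) =
      M.map f (freeModuleLift (v d) (freeModuleBasis X x))
    rw [freeModule_map_basis, freeModuleLift_basis, freeModuleLift_basis, hv]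

theorem freeModuleDesc_basis {M : D ⥤ AddCommGrpCat.{u}} (v : ∀ d, X.obj d → M.obj d)
    (hv : ∀ {d e : D} (f : d ⟶ e) (x : X.obj d), M.map f (v d x) = v e (X.map f x)) (d : D)
    (x : X.obj d) : (freeModuleDesc v hv).app d (freeModuleBasis X x) = v d x :=
  freeModuleLift_basis _ _

-- The identity of `d` is initial in the category of elements of a representable functor, so the
-- constant module there is projective, and induction preserves this.
variable (D) in
theorem projective_freeModule_coyoneda (d : D) :
    Projective (freeModule (coyoneda.obj (Opposite.op d))) := by
  refine projective_inducedModule _ (projective_constantModule (I := Unit)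
    (fun _ => ⟨d, 𝟙 d⟩) fun j => ⟨⟨⟨⟨(), ⟨j.2, by simp⟩⟩⟩, ?_⟩⟩)
  rintro ⟨⟨⟩, ⟨f, hf⟩⟩
  congr
  simpa using hf

instance : EnoughProjectives (D ⥤ AddCommGrpCat.{u}) where
  presentation M := by
    let v (p : Σ d, M.obj d) : freeModule (coyoneda.obj (Opposite.op p.1)) ⟶ M :=
      freeModuleDesc (fun e f => M.map f p.2) fun f g => by simp
    refine ⟨{
      p := _
      projective := projective_moduleSum _ fun p : Σ d, M.obj d =>
        projective_freeModule_coyoneda D p.1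
      f := moduleSumDesc v
      epi := epi_moduleSumDesc _ fun d x => ?_ }⟩
    refine ⟨⟨d, x⟩, freeModuleBasis _ (𝟙 d), ?_⟩
    exact (freeModuleDesc_basis _ _ _ _).trans (by simp)

end Elements

/-! ### Equivariant maps out of `G ⧸ H`. -/

section EquivariantMaps

variable {G : Type*} [Group G]

theorem quotient_hom_ext {H : Subgroup G} {Y : Type*} [MulAction G Y] {f g : (G ⧸ H) →[G] Y}
    (h : f ((1 : G) : G ⧸ H) = g ((1 : G) : G ⧸ H)) : f = g := by
  ext x
  obtain ⟨x, rfl⟩ := QuotientGroup.mk_surjective x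
  have hx : (x : G ⧸ H) = x • ((1 : G) : G ⧸ H) := by simp
  rw [hx, map_smul, map_smul, h]

/-- The `G`-map `G ⧸ H → Y` determined by an `H`-fixed point of `Y`. -/
def quotientHom {H : Subgroup G} {Y : Type*} [MulAction G Y] (y : Y) (hy : ∀ h ∈ H, h • y = y) :
    (G ⧸ H) →[G] Y where
  toFun := Quotient.lift (fun g : G => g • y) fun a b hab => by
    have hab := hy _ (QuotientGroup.leftRel_apply.1 hab)
    rw [mul_smul, inv_smul_eq_iff] at hab
    exact hab.symm
  map_smul' g x := by
    obtain ⟨x, rfl⟩ := QuotientGroup.mk_surjective x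
    exact mul_smul g x y

theorem quotientHom_one {H : Subgroup G} {Y : Type*} [MulAction G Y] (y : Y)
    (hy : ∀ h ∈ H, h • y = y) : quotientHom y hy ((1 : G) : G ⧸ H) = y :=
  one_smul _ _

theorem smul_quotientHom_one {H : Subgroup G} {Y : Type*} [MulAction G Y] (f : (G ⧸ H) →[G] Y)
    {h : G} (hh : h ∈ H) : h • f ((1 : G) : G ⧸ H) = f ((1 : G) : G ⧸ H) := by
  rw [← map_smul]
  congr 1
  exact QuotientGroup.eq.2 (by simpa using hh)

end EquivariantMaps

/-! ### Permutation modules, and orbits over `G ⧸ K`. -/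

namespace SubgroupFamily

variable {G : Type u} [Group G]

/-- The presheaf of fixed points of a `G`-set on the orbit category. -/
def fixedPointFunctor (F : SubgroupFamily G) (Y : Type u) [MulAction G Y] :
    F.Orbitᵒᵖ ⥤ Type u where
  obj A := (G ⧸ A.unop.stabilizer) →[G] Y
  map f := ↾fun h => h.comp f.unop
  map_id _ := rfl
  map_comp _ _ := rfl

section FixedPointElements

variable {F : SubgroupFamily G} {Y : Type u} [MulAction G Y]

/-- A `G`-map from an orbit to `Y`, as an element of the fixed point functor. -/
def fixedPointElement (A : F.Orbit) (x : (G ⧸ A.stabilizer) →[G] Y) :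
    (F.fixedPointFunctor Y).Elements := ⟨Opposite.op A, x⟩

/-- Morphisms of elements of the fixed point functor from maps of orbits over `Y`. -/
def fixedPointElementHom {A B : F.Orbit} {x : (G ⧸ A.stabilizer) →[G] Y}
    {y : (G ⧸ B.stabilizer) →[G] Y} (f : (G ⧸ B.stabilizer) →[G] (G ⧸ A.stabilizer))
    (hf : x.comp f = y) : fixedPointElement A x ⟶ fixedPointElement B y :=
  ⟨Quiver.Hom.op (X := B) (Y := A) f, hf⟩

/-- The map of orbits underlying a morphism of elements of the fixed point functor. -/
def mapOfElementHom {A B : F.Orbit} {x : (G ⧸ A.stabilizer) →[G] Y}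
    {y : (G ⧸ B.stabilizer) →[G] Y} (φ : fixedPointElement A x ⟶ fixedPointElement B y) :
    (G ⧸ B.stabilizer) →[G] (G ⧸ A.stabilizer) := φ.1.unop

theorem apply_mapOfElementHom {A B : F.Orbit} {x : (G ⧸ A.stabilizer) →[G] Y}
    {y : (G ⧸ B.stabilizer) →[G] Y} (φ : fixedPointElement A x ⟶ fixedPointElement B y)
    (z : G ⧸ B.stabilizer) : x (mapOfElementHom φ z) = y z :=
  DFunLike.congr_fun (F := (G ⧸ B.stabilizer) →[G] Y) φ.2 z

theorem fixedPointElement_hom_ext {A B : F.Orbit} {x : (G ⧸ A.stabilizer) →[G] Y}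
    {y : (G ⧸ B.stabilizer) →[G] Y} {φ ψ : fixedPointElement A x ⟶ fixedPointElement B y}
    (h : mapOfElementHom φ ((1 : G) : G ⧸ B.stabilizer) =
      mapOfElementHom ψ ((1 : G) : G ⧸ B.stabilizer)) : φ = ψ :=
  CategoryOfElements.ext _ _ _ (Quiver.Hom.unop_inj (quotient_hom_ext h))

end FixedPointElements

/-- Permutation modules on sets with stabilizers in the family are projective. -/
theorem projective_freeModule_fixedPointFunctor (F : SubgroupFamily G) (Y : Type u)
    [MulAction G Y] (hY : ∀ y : Y, MulAction.stabilizer G y ∈ F.carrier) :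
    Projective (freeModule (F.fixedPointFunctor Y)) := by
  let S (o : MulAction.orbitRel.Quotient G Y) : F.Orbit := ⟨MulAction.stabilizer G o.out, hY _⟩
  let b (o : MulAction.orbitRel.Quotient G Y) : (G ⧸ (S o).stabilizer) →[G] Y :=
    quotientHom o.out fun _ h => h
  -- A `G`-map from a transitive set to `Y` lands in one orbit of `Y` and factors uniquely through
  -- the inclusion of that orbit.
  refine projective_inducedModule _ (projective_constantModule
    (fun o => fixedPointElement (S o) (b o)) ?_)
  rintro ⟨⟨A⟩, x⟩
  change (G ⧸ A.stabilizer) →[G] Y at x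
  change Nonempty (Unique (Σ o, (fixedPointElement (S o) (b o) ⟶ fixedPointElement A x)))
  have hb (o) (g : G) : b o (g : G ⧸ (S o).stabilizer) = g • o.out := rfl
  rw [unique_iff_subsingleton_and_nonempty]
  constructor
  · constructor
    rintro ⟨o, φ⟩ ⟨o', φ'⟩
    have ho (o) (φ : fixedPointElement (S o) (b o) ⟶ fixedPointElement A x) :
        o = Quotient.mk'' (x ((1 : G) : G ⧸ A.stabilizer)) := by
      obtain ⟨g, hg⟩ := QuotientGroup.mk_surjective (mapOfElementHom φ ((1 : G) : G ⧸ A.stabilizer))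
      rw [← apply_mapOfElementHom φ, ← hg, hb]
      refine (Quotient.out_eq' o).symm.trans (Quotient.sound' ?_)
      exact ⟨g⁻¹, by simp⟩
    obtain rfl : o = o' := (ho o φ).trans (ho o' φ').symm
    congr 1
    refine fixedPointElement_hom_ext ?_
    have h := (apply_mapOfElementHom φ ((1 : G) : G ⧸ A.stabilizer)).trans
      (apply_mapOfElementHom φ' ((1 : G) : G ⧸ A.stabilizer)).symm
    obtain ⟨g, hg⟩ := QuotientGroup.mk_surjective (mapOfElementHom φ ((1 : G) : G ⧸ A.stabilizer))
    obtain ⟨g', hg'⟩ :=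
      QuotientGroup.mk_surjective (mapOfElementHom φ' ((1 : G) : G ⧸ A.stabilizer))
    rw [← hg, ← hg', hb, hb] at h
    rw [← hg, ← hg', QuotientGroup.eq]
    change _ • _ = _
    rw [mul_smul, ← h, inv_smul_smul]
  · let y := x ((1 : G) : G ⧸ A.stabilizer)
    let o : MulAction.orbitRel.Quotient G Y := Quotient.mk'' y
    obtain ⟨g, hg⟩ : ∃ g : G, g • o.out = y := by
      have : MulAction.orbitRel G Y y o.out := Quotient.exact' (Quotient.out_eq' o).symm
      exact this
    have hfix : ∀ a ∈ A.stabilizer, a • (g : G ⧸ (S o).stabilizer) = g := by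
      intro a ha
      have hay : a • y = y := smul_quotientHom_one x ha
      change ((a * g : G) : G ⧸ (S o).stabilizer) = _
      rw [eq_comm, QuotientGroup.eq]
      change _ • _ = _
      rw [mul_smul, mul_smul, hg, hay, ← hg, inv_smul_smul]
    exact ⟨o, fixedPointElementHom (quotientHom (g : G ⧸ (S o).stabilizer) hfix)
      (quotient_hom_ext ((congrArg (b o) (quotientHom_one _ hfix)).trans hg))⟩

section QuotientInclusion

variable {K : Subgroup G}

/-- The inclusion `K ⧸ L → G ⧸ L` for `L ≤ K ≤ G`. -/
def quotientInclusion (L : Subgroup K) : K ⧸ L → G ⧸ L.map K.subtype :=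
  Quotient.lift (fun k : K => ((k : G) : G ⧸ L.map K.subtype)) fun a b hab =>
    QuotientGroup.eq.2 ⟨a⁻¹ * b, QuotientGroup.leftRel_apply.1 hab, by simp⟩

theorem quotientInclusion_smul (L : Subgroup K) (k : K) (x : K ⧸ L) :
    quotientInclusion L (k • x) = (k : G) • quotientInclusion L x := by
  obtain ⟨x, rfl⟩ := QuotientGroup.mk_surjective x
  rfl

theorem quotientInclusion_injective (L : Subgroup K) :
    Function.Injective (quotientInclusion L) := by
  intro x y h
  obtain ⟨x, rfl⟩ := QuotientGroup.mk_surjective x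
  obtain ⟨y, rfl⟩ := QuotientGroup.mk_surjective y
  obtain ⟨l, hl, hxy⟩ := QuotientGroup.eq.1 h
  obtain rfl : l = x⁻¹ * y := Subtype.ext (by simpa using hxy)
  exact QuotientGroup.eq.2 hl

/-- The projection `G ⧸ L → G ⧸ K` for `L ≤ K ≤ G`. -/
def quotientProjection (L : Subgroup K) : (G ⧸ L.map K.subtype) →[G] (G ⧸ K) :=
  quotientHom ((1 : G) : G ⧸ K) fun h hh => by
    obtain ⟨k, -, rfl⟩ := hh
    exact QuotientGroup.eq.2 (by simp)

theorem quotientProjection_inclusion (L : Subgroup K) (x : K ⧸ L) :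
    quotientProjection L (quotientInclusion L x) = ((1 : G) : G ⧸ K) := by
  obtain ⟨x, rfl⟩ := QuotientGroup.mk_surjective x
  exact QuotientGroup.eq.2 (by simp)

theorem exists_quotientInclusion_eq (L : Subgroup K) (z : G ⧸ L.map K.subtype)
    (hz : quotientProjection L z = ((1 : G) : G ⧸ K)) : ∃ x, quotientInclusion L x = z := by
  obtain ⟨g, rfl⟩ := QuotientGroup.mk_surjective z
  have hg : ((g * 1 : G) : G ⧸ K) = ((1 : G) : G ⧸ K) := hz
  rw [eq_comm, QuotientGroup.eq] at hg
  exact ⟨((⟨g, by simpa using hg⟩ : K) : K ⧸ L), rfl⟩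

/-- The extension of a `K`-map between `K`-orbits to a `G`-map between `G`-orbits. -/
def extendHom {L L' : Subgroup K} (f : (K ⧸ L) →[K] (K ⧸ L')) :
    (G ⧸ L.map K.subtype) →[G] (G ⧸ L'.map K.subtype) :=
  quotientHom (quotientInclusion L' (f ((1 : K) : K ⧸ L))) fun h hh => by
    obtain ⟨k, hk, rfl⟩ := hh
    exact (quotientInclusion_smul _ _ _).symm.trans (congrArg _ (smul_quotientHom_one f hk))

theorem extendHom_one {L L' : Subgroup K} (f : (K ⧸ L) →[K] (K ⧸ L')) :
    extendHom f ((1 : G) : G ⧸ L.map K.subtype) =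
      quotientInclusion L' (f ((1 : K) : K ⧸ L)) :=
  quotientHom_one _ _

theorem extendHom_inclusion {L L' : Subgroup K} (f : (K ⧸ L) →[K] (K ⧸ L')) (x : K ⧸ L) :
    extendHom f (quotientInclusion L x) = quotientInclusion L' (f x) := by
  obtain ⟨x, rfl⟩ := QuotientGroup.mk_surjective x
  have hx : (x : K ⧸ L) = x • ((1 : K) : K ⧸ L) := by simp
  rw [hx, quotientInclusion_smul, map_smul, map_smul, quotientInclusion_smul]
  exact congrArg _ (extendHom_one f)

theorem projection_comp_extendHom {L L' : Subgroup K} (f : (K ⧸ L) →[K] (K ⧸ L')) :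
    (quotientProjection L').comp (extendHom f) = quotientProjection L := by
  refine quotient_hom_ext ?_
  change quotientProjection L' (extendHom f _) = _
  rw [extendHom_one, quotientProjection_inclusion]
  exact (quotientProjection_inclusion L ((1 : K) : K ⧸ L)).symm

end QuotientInclusion

section OrbitsOverQuotient

variable (F : SubgroupFamily G) (K : Subgroup G)

/-- An orbit of `K` gives an orbit of `G` over `G ⧸ K`. -/
def extendOrbit (B : (F.inter K).Orbit) : F.Orbit where
  stabilizer := B.stabilizer.map K.subtype
  mem := by
    obtain ⟨H, hH, h⟩ := B.mem
    refine F.mem_of_le _ H ?_ hH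
    rw [h]
    exact Subgroup.map_le_iff_le_comap.2 le_rfl

/-- The functor from orbits of `K` to orbits of `G` over `G ⧸ K`. -/
def orbitsOverQuotient : (F.inter K).Orbitᵒᵖ ⥤ (F.fixedPointFunctor (G ⧸ K)).Elements where
  obj B := fixedPointElement (F.extendOrbit K B.unop) (quotientProjection B.unop.stabilizer)
  map {B B'} f := fixedPointElementHom (A := F.extendOrbit K B.unop) (B := F.extendOrbit K B'.unop)
    (extendHom f.unop) (projection_comp_extendHom _)
  map_id B := by
    refine fixedPointElement_hom_ext ?_
    exact extendHom_one _
  map_comp f g := by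
    refine fixedPointElement_hom_ext ?_
    refine (extendHom_one _).trans ?_
    refine (Eq.trans ?_ (congrArg (extendHom f.unop) (extendHom_one g.unop)).symm)
    exact (extendHom_inclusion f.unop _).symm

instance : (orbitsOverQuotient F K).Faithful where
  map_injective {B B'} f g h := by
    refine Quiver.Hom.unop_inj (quotient_hom_ext (quotientInclusion_injective _ ?_))
    refine (extendHom_one f.unop).symm.trans (Eq.trans ?_ (extendHom_one g.unop))
    exact congr(mapOfElementHom $h ((1 : G) : G ⧸ (F.extendOrbit K B'.unop).stabilizer))

/-- A `G`-map over `G ⧸ K` preserves fibres over the base coset, and the fibre of `G ⧸ L` there is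
`K ⧸ L`; the image of the base point is a fixed point defining the required `K`-map. -/
instance : (orbitsOverQuotient F K).Full where
  map_surjective {B B'} φ := by
    let h := mapOfElementHom φ
    obtain ⟨w, hw⟩ := exists_quotientInclusion_eq B.unop.stabilizer
      (h ((1 : G) : G ⧸ (F.extendOrbit K B'.unop).stabilizer))
      ((apply_mapOfElementHom φ _).trans (quotientProjection_inclusion B'.unop.stabilizer
        ((1 : K) : K ⧸ B'.unop.stabilizer)))
    have hfix : ∀ l ∈ B'.unop.stabilizer, l • w = w := by
      intro l hl
      refine quotientInclusion_injective _ ?_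
      rw [quotientInclusion_smul, hw]
      exact smul_quotientHom_one h ⟨l, hl, rfl⟩
    exact ⟨Quiver.Hom.op (X := B'.unop) (Y := B.unop) (quotientHom w hfix),
      fixedPointElement_hom_ext
        ((extendHom_one _).trans ((congrArg _ (quotientHom_one w hfix)).trans hw))⟩

/-- If `x` sends the base coset of `G ⧸ A` to `gK`, then `g⁻¹Ag ≤ K`, and translation by `g`
identifies `x` with the projection from `G ⧸ g⁻¹Ag`. -/
instance : (orbitsOverQuotient F K).EssSurj where
  mem_essImage := by
    rintro ⟨⟨A⟩, x⟩
    change (G ⧸ A.stabilizer) →[G] (G ⧸ K) at x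
    obtain ⟨g, hg⟩ := QuotientGroup.mk_surjective (x ((1 : G) : G ⧸ A.stabilizer))
    let C : Subgroup G := A.stabilizer.map (MulAut.conj g⁻¹).toMonoidHom
    have hC : C ≤ K := by
      rintro _ ⟨a, ha, rfl⟩
      have := smul_quotientHom_one x ha
      rw [← hg] at this
      simpa [mul_assoc] using QuotientGroup.eq.1 this.symm
    have hmap : (C.subgroupOf K).map K.subtype = C := by
      rw [Subgroup.subgroupOf_map_subtype, inf_of_le_left hC]
    let B : (F.inter K).Orbit := ⟨C.subgroupOf K, C, F.conj_mem _ _ A.mem, rfl⟩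
    let B' := F.extendOrbit K B
    have hB' (c : G) : c ∈ B'.stabilizer ↔ g * c * g⁻¹ ∈ A.stabilizer := by
      change c ∈ (C.subgroupOf K).map K.subtype ↔ _
      rw [hmap]
      constructor
      · rintro ⟨a, ha, rfl⟩
        simpa [mul_assoc] using ha
      · intro h
        exact ⟨_, h, by simp [mul_assoc]⟩
    let p : (G ⧸ B'.stabilizer) →[G] (G ⧸ K) := quotientProjection B.stabilizer
    have hp (c : G) : p (c : G ⧸ B'.stabilizer) = (c : G ⧸ K) := congrArg _ (mul_one c)
    let u : (G ⧸ A.stabilizer) →[G] (G ⧸ B'.stabilizer) :=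
      quotientHom (g : G ⧸ B'.stabilizer) fun a ha => by
        refine (QuotientGroup.eq.2 ((hB' _).2 ?_)).symm
        simpa [mul_assoc] using ha
    let v : (G ⧸ B'.stabilizer) →[G] (G ⧸ A.stabilizer) :=
      quotientHom ((g⁻¹ : G) : G ⧸ A.stabilizer) fun c hc => by
        refine (QuotientGroup.eq.2 ?_).symm
        simpa [mul_assoc] using (hB' c).1 hc
    have hu : u ((1 : G) : G ⧸ A.stabilizer) = (g : G ⧸ B'.stabilizer) := quotientHom_one _ _
    have hv : v ((1 : G) : G ⧸ B'.stabilizer) = ((g⁻¹ : G) : G ⧸ A.stabilizer) :=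
      quotientHom_one _ _
    have huv : u (v ((1 : G) : G ⧸ B'.stabilizer)) = ((1 : G) : G ⧸ B'.stabilizer) := by
      rw [hv]
      exact congrArg _ (inv_mul_cancel g)
    have hvu : v (u ((1 : G) : G ⧸ A.stabilizer)) = ((1 : G) : G ⧸ A.stabilizer) := by
      rw [hu]
      exact congrArg _ (mul_inv_cancel g)
    have hpu : p.comp u = x :=
      quotient_hom_ext ((congrArg p hu).trans ((hp g).trans hg))
    have hxv : x.comp v = p := by
      rw [← hpu]
      exact quotient_hom_ext (congrArg p huv)
    refine ⟨Opposite.op B, ⟨?_⟩⟩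
    exact
      { hom := fixedPointElementHom (A := B') (B := A) (x := p) (y := x) u hpu
        inv := fixedPointElementHom (A := A) (B := B') (x := x) (y := p) v hxv
        hom_inv_id := fixedPointElement_hom_ext (A := B') (B := B') huv
        inv_hom_id := fixedPointElement_hom_ext (A := A) (B := A) hvu }

instance : (orbitsOverQuotient F K).IsEquivalence where

/-- The permutation module on `G ⧸ K` is induced from the trivial module of `K`. -/
theorem hasProjectiveDimensionLT_freeModule_quotient (n : ℕ)
    (h : HasProjectiveDimensionLT (F.inter K).trivialModule n) :
    HasProjectiveDimensionLT (freeModule (F.fixedPointFunctor (G ⧸ K))) n := by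
  let e := (orbitsOverQuotient F K).asEquivalence
  have he : HasProjectiveDimensionLT ((restriction e.inverse).obj (F.inter K).trivialModule) n :=
    hasProjectiveDimensionLT_obj_of_preservesProjectives (restriction e.inverse)
      (shortExact_restriction _)
      (fun P hP => (e.congrLeft (E := AddCommGrpCat.{u})).map_projective_iff P |>.2 hP) n _ h
  -- Restricting a constant module gives a constant module, definitionally, so what is induced here
  -- is the free module.
  exact hasProjectiveDimensionLT_obj_of_preservesProjectives
    (inducedModuleFunctor (F.fixedPointFunctor (G ⧸ K))) shortExact_inducedModuleFunctor
    (fun P hP => projective_inducedModule P hP) n _ he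

end OrbitsOverQuotient

end SubgroupFamily

/-! ### Comparison of two families, and actions on trees. -/

namespace SubgroupFamily

variable {G : Type u} [Group G]

section Comparison

variable {F F' : SubgroupFamily G}

/-- The inclusion of orbit categories given by an inclusion of families. -/
def orbitInclusion (h : F.carrier ⊆ F'.carrier) : F.Orbit ⥤ F'.Orbit where
  obj A := ⟨A.stabilizer, h A.mem⟩
  map f := f

theorem stabilizer_quotient_mem (A : F.Orbit) (x : G ⧸ A.stabilizer) :
    MulAction.stabilizer G x ∈ F.carrier := by
  obtain ⟨g, rfl⟩ := QuotientGroup.mk_surjective x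
  refine F.mem_of_le _ _ (fun h hh => ?_) (F.conj_mem g _ A.mem)
  have hh : ((h * g : G) : G ⧸ A.stabilizer) = g := hh
  rw [eq_comm, QuotientGroup.eq] at hh
  exact ⟨_, hh, by simp [mul_assoc]⟩

theorem map_fixedPointFunctor_map (M : F.BredonModule) (A : F.Orbit) (m : M.obj (Opposite.op A))
    {B C : F.Orbitᵒᵖ} (f : B ⟶ C) (x : (F.fixedPointFunctor (G ⧸ A.stabilizer)).obj B) :
    M.map f (M.map (Quiver.Hom.op (X := B.unop) (Y := A) x) m) =
      M.map (Quiver.Hom.op (X := C.unop) (Y := A)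
        ((F.fixedPointFunctor (G ⧸ A.stabilizer)).map f x)) m :=
  congr($(M.map_comp (Quiver.Hom.op (X := B.unop) (Y := A) x) f) m).symm

/-- The map from the free module on an orbit determined by an element of a Bredon module. -/
noncomputable def orbitModuleDesc (M : F.BredonModule) (A : F.Orbit) (m : M.obj (Opposite.op A)) :
    freeModule (F.fixedPointFunctor (G ⧸ A.stabilizer)) ⟶ M :=
  freeModuleDesc (fun B f => M.map (Quiver.Hom.op (X := B.unop) (Y := A) f) m)
    (map_fixedPointFunctor_map M A m)

theorem orbitModuleDesc_basis (M : F.BredonModule) (A : F.Orbit) (m : M.obj (Opposite.op A)) :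
    (orbitModuleDesc M A m).app (Opposite.op A)
      (freeModuleBasis (F.fixedPointFunctor (G ⧸ A.stabilizer)) (d := Opposite.op A)
        (MulActionHom.id G)) = m :=
  (freeModuleDesc_basis _ (map_fixedPointFunctor_map M A m) _ _).trans congr($(M.map_id (Opposite.op A)) m)

theorem epi_orbitModuleDesc (M : F.BredonModule) :
    Epi (moduleSumDesc fun p : Σ A : F.Orbit, M.obj (Opposite.op A) =>
      orbitModuleDesc M p.1 p.2) := by
  exact epi_moduleSumDesc _ fun d x => ⟨⟨d.unop, x⟩, _, orbitModuleDesc_basis M d.unop x⟩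

theorem hasProjectiveDimensionLT_trivialModule_of_subset (h : F.carrier ⊆ F'.carrier) (d : ℕ)
    (hd : ∀ H ∈ F'.carrier, HasProjectiveDimensionLT (F.inter H).trivialModule (d + 1)) (n : ℕ)
    (hn : HasProjectiveDimensionLT F'.trivialModule n) :
    HasProjectiveDimensionLT F.trivialModule (n + d) := by
  refine hasProjectiveDimensionLT_obj_of_presentations (restriction (orbitInclusion h).op)
    (shortExact_restriction _) d (fun M => ?_) n F'.trivialModule hn
  refine ⟨_, _, ?_, epi_orbitModuleDesc M, ?_⟩
  · exact projective_moduleSum _ fun p =>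
      projective_freeModule_fixedPointFunctor F' _ (stabilizer_quotient_mem p.1)
  -- Fixed points of `G ⧸ K` are given by the same formula over both orbit categories, so the
  -- restricted cover is definitionally the same sum of permutation modules.
  · exact hasProjectiveDimensionLT_moduleSum (d + 1)
      (fun p : Σ A : F'.Orbit, M.obj (Opposite.op A) =>
        freeModule (F.fixedPointFunctor (G ⧸ p.1.stabilizer)))
      fun p => hasProjectiveDimensionLT_freeModule_quotient F _ _ (hd _ p.1.mem)

theorem cd_le_cd_add (h : F.carrier ⊆ F'.carrier) (d : ℕ)
    (hd : ∀ H ∈ F'.carrier, (F.inter H).cd ≤ (d : WithBot ℕ∞)) :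
    F.cd ≤ F'.cd + (d : WithBot ℕ∞) := by
  have hd' : ∀ H ∈ F'.carrier, HasProjectiveDimensionLT (F.inter H).trivialModule (d + 1) :=
    fun H hH => (projectiveDimension_le_iff _ _).1 (hd H hH)
  have key := hasProjectiveDimensionLT_trivialModule_of_subset h d hd'
  obtain hF' | ⟨n, hF'⟩ | hF' :
      F'.cd = ⊥ ∨ (∃ n : ℕ, F'.cd = (n : WithBot ℕ∞)) ∨ F'.cd = ⊤ := by
    generalize F'.cd = c
    induction c with
    | bot => exact Or.inl rfl
    | coe c =>
      induction c with
      | top => exact Or.inr (Or.inr rfl)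
      | coe c => exact Or.inr (Or.inl ⟨c, rfl⟩)
  · have hz : IsZero F.trivialModule :=
      (restriction (orbitInclusion h).op).map_isZero ((projectiveDimension_eq_bot_iff _).1 hF')
    have : F.cd = ⊥ := (projectiveDimension_eq_bot_iff _).2 hz
    rw [this]
    exact bot_le
  · have := key (n + 1) ((projectiveDimension_le_iff _ _).1 hF'.le)
    rw [hF', ← Nat.cast_add]
    refine (projectiveDimension_le_iff _ _).2 ?_
    rwa [show n + 1 + d = n + d + 1 by omega] at this
  · rw [hF']
    exact le_top

end Comparison

section Tree

open scoped Classical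

/-- If `G` acts on a graph with stabilizers in the family such that the fixed subgraph of each
member of the family is a tree, then the cohomological dimension is at most one. Being a tree is
expressed through cochains: every `1`-cochain is a coboundary and every `0`-cocycle is constant. -/
theorem cd_le_one_of_tree (F : SubgroupFamily G) {V E : Type u} [MulAction G V] [MulAction G E]
    (s t : E →[G] V) (hV : ∀ v : V, MulAction.stabilizer G v ∈ F.carrier)
    (hE : ∀ e : E, MulAction.stabilizer G e ∈ F.carrier)
    (hne : ∀ L ∈ F.carrier, ∃ v : V, ∀ l ∈ L, l • v = v)
    (hint : ∀ L ∈ F.carrier, ∀ (A : Type u) [AddCommGroup A] (g : E → A), ∃ p : V → A,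
      ∀ e : E, (∀ l ∈ L, l • e = e) → p (t e) - p (s e) = g e)
    (hconn : ∀ L ∈ F.carrier, ∀ (A : Type u) (q : V → A),
      (∀ e : E, (∀ l ∈ L, l • e = e) → q (t e) = q (s e)) →
      ∀ v w : V, (∀ l ∈ L, l • v = v) → (∀ l ∈ L, l • w = w) → q v = q w) :
    F.cd ≤ ((1 : ℕ) : WithBot ℕ∞) := by
  let ZE := freeModule (F.fixedPointFunctor E)
  let ZV := freeModule (F.fixedPointFunctor V)
  let b (A : F.Orbitᵒᵖ) (x : (G ⧸ A.unop.stabilizer) →[G] V) : ZV.obj A :=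
    freeModuleBasis (F.fixedPointFunctor V) (d := A) x
  let c (A : F.Orbitᵒᵖ) (x : (G ⧸ A.unop.stabilizer) →[G] E) : ZE.obj A :=
    freeModuleBasis (F.fixedPointFunctor E) (d := A) x
  let ε : ZV ⟶ F.trivialModule :=
    freeModuleDesc (fun _ _ => (⟨1⟩ : ULift.{u} ℤ)) fun _ _ => rfl
  let δ : ZE ⟶ ZV := freeModuleDesc (fun A x => b A (t.comp x) - b A (s.comp x)) fun {A B} f x => by
    rw [map_sub]
    exact congrArg₂ _ (freeModule_map_basis f _) (freeModule_map_basis f _)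
  have hε (A) (x) : ε.app A (b A x) = (⟨1⟩ : ULift.{u} ℤ) := freeModuleDesc_basis _ _ _ _
  have hδ (A) (x) : δ.app A (c A x) = b A (t.comp x) - b A (s.comp x) :=
    freeModuleDesc_basis _ _ _ _
  have hδε : δ ≫ ε = 0 := by
    refine NatTrans.ext (funext fun A => AddCommGrpCat.hom_ext (freeModule_addHom_ext fun x => ?_))
    change (G ⧸ A.unop.stabilizer) →[G] E at x
    change ε.app A (δ.app A (c A x)) = 0
    rw [hδ, map_sub, hε, hε]
    exact sub_self _
  have hS : (ShortComplex.mk δ ε hδε).ShortExact := by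
    rw [shortExact_iff_evaluation]
    intro A
    obtain ⟨v₀, hv₀⟩ := hne _ A.unop.mem
    refine ⟨?_, ?_, ?_⟩
    -- For the tautological cochain, sending each fixed edge to its own basis element, an integral
    -- `p` yields a retraction `r` of `δ`. The value `0` on other edges is never used.
    · obtain ⟨p, hp⟩ := hint _ A.unop.mem (ZE.obj A)
        fun e => if h : ∀ l ∈ A.unop.stabilizer, l • e = e then c A (quotientHom e h) else 0
      let r : ZV.obj A →+ ZE.obj A := freeModuleLift
        fun x : (G ⧸ A.unop.stabilizer) →[G] V => p (x ((1 : G) : G ⧸ A.unop.stabilizer))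
      have hr (x) : r (b A x) = p (x ((1 : G) : G ⧸ A.unop.stabilizer)) := freeModuleLift_basis _ _
      have hrδ : r.comp (δ.app A).hom = AddMonoidHom.id _ := by
        refine freeModule_addHom_ext fun x => ?_
        change (G ⧸ A.unop.stabilizer) →[G] E at x
        change r (δ.app A (c A x)) = c A x
        have hx : ∀ l ∈ A.unop.stabilizer, l • x ((1 : G) : G ⧸ A.unop.stabilizer) =
          x ((1 : G) : G ⧸ A.unop.stabilizer) := fun l hl => smul_quotientHom_one x hl
        rw [hδ, map_sub, hr, hr]
        refine (hp _ hx).trans ?_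
        rw [dif_pos hx]
        exact congrArg _ (quotient_hom_ext (quotientHom_one _ hx))
      exact Function.LeftInverse.injective (g := r) fun y => congr($hrδ y)
    · rintro ⟨n⟩
      refine ⟨n • b A (quotientHom v₀ hv₀), ?_⟩
      rw [map_zsmul]
      refine (congrArg (n • ·) (hε A _)).trans ?_
      refine ULift.ext _ _ ?_
      change n • (1 : ℤ) = n
      simp
    · intro y
      constructor
      · intro hy
        let R := (δ.app A).hom.range
        -- The tautological `0`-cochain modulo boundaries is a cocycle, hence constant on fixed
        -- vertices; so the quotient map by the image of `δ` factors through `ε`.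
        let q (v : V) : (ZV.obj A) ⧸ R :=
          if h : ∀ l ∈ A.unop.stabilizer, l • v = v then
            QuotientAddGroup.mk (b A (quotientHom v h)) else 0
        have hq (x : (G ⧸ A.unop.stabilizer) →[G] V) :
            q (x ((1 : G) : G ⧸ A.unop.stabilizer)) = QuotientAddGroup.mk (b A x) := by
          have hx : ∀ l ∈ A.unop.stabilizer, l • x ((1 : G) : G ⧸ A.unop.stabilizer) =
            x ((1 : G) : G ⧸ A.unop.stabilizer) := fun l hl => smul_quotientHom_one x hl
          refine (dif_pos hx).trans (congrArg _ (congrArg _ ?_))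
          exact quotient_hom_ext (quotientHom_one _ hx)
        have hconst (x : (G ⧸ A.unop.stabilizer) →[G] V) :
            (QuotientAddGroup.mk (b A x) : (ZV.obj A) ⧸ R) = q v₀ := by
          rw [← hq]
          refine hconn _ A.unop.mem _ q (fun e he => ?_) _ _
            (fun l hl => smul_quotientHom_one x hl) hv₀
          have ht := hq (t.comp (quotientHom e he))
          have hs := hq (s.comp (quotientHom e he))
          rw [MulActionHom.comp_apply, quotientHom_one] at ht hs
          rw [ht, hs, eq_comm, QuotientAddGroup.eq]
          refine ⟨c A (quotientHom e he), (hδ A _).trans ?_⟩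
          abel
        have hmk : QuotientAddGroup.mk' R =
            ((zmultiplesHom _ (q v₀)).comp AddEquiv.ulift.toAddMonoidHom).comp (ε.app A).hom := by
          refine freeModule_addHom_ext fun x => ?_
          change (G ⧸ A.unop.stabilizer) →[G] V at x
          refine (hconst x).trans ?_
          change _ = (ε.app A (b A x)).down • q v₀
          rw [hε, one_zsmul]
        have hy' : (QuotientAddGroup.mk' R) y = 0 := by
          rw [hmk]
          change (ε.app A y).down • q v₀ = 0
          have hy : ε.app A y = 0 := hy
          rw [hy]
          exact zero_zsmul _
        exact (QuotientAddGroup.eq_zero_iff _).1 hy'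
      · rintro ⟨x, rfl⟩
        exact congr(($hδε).app A x)
  have hZE : Projective ZE := projective_freeModule_fixedPointFunctor F E hE
  have hZV : Projective ZV := projective_freeModule_fixedPointFunctor F V hV
  exact (projectiveDimension_le_iff _ _).2
    (hS.hasProjectiveDimensionLT_X₃ 1 inferInstance inferInstance)

end Tree

end SubgroupFamily

/-! ### A sign and a cocycle on an infinite virtually cyclic group. -/

section AffineCocycle

variable {V : Type u} [Group V]

/-- An infinite virtually cyclic group has an infinite cyclic normal subgroup of finite index. -/
theorem IsVirtuallyCyclic.exists_normal_mulEquiv_int [Infinite V] (h : IsVirtuallyCyclic V) :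
    ∃ N : Subgroup V, N.Normal ∧ N.FiniteIndex ∧ Nonempty (N ≃* Multiplicative ℤ) := by
  obtain ⟨C, hC, hC'⟩ := h
  refine ⟨C.normalCore, inferInstance, inferInstance, ?_⟩
  have hcyc : IsCyclic C.normalCore :=
    isCyclic_of_injective (Subgroup.inclusion C.normalCore_le)
      (Subgroup.inclusion_injective C.normalCore_le)
  have hinf : Infinite C.normalCore := by
    by_contra hfin
    rw [not_infinite_iff_finite] at hfin
    have : Finite (V ⧸ C.normalCore) := inferInstance
    have : Finite V := Finite.of_subgroup_quotient C.normalCore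
    exact not_finite V
  exact ⟨(intCyclicMulEquiv (G := C.normalCore)).symm⟩

/-- Conjugation acts on an infinite cyclic group by multiplication by a unit of `ℤ`, and `N`, being
commutative, acts trivially on itself. -/
theorem exists_sign_of_normal_mulEquiv_int (N : Subgroup V) [N.Normal]
    (φ : N ≃* Multiplicative ℤ) :
    ∃ ε : V →* ℤ, (∀ v, ε v = 1 ∨ ε v = -1) ∧ (∀ n : N, ε n = 1) ∧
      ∀ (v : V) (n : N), (φ (MulAut.conjNormal v n)).toAdd = ε v * (φ n).toAdd := by
  let τ : N := φ.symm (Multiplicative.ofAdd 1)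
  have hτ (n : N) : n = τ ^ (φ n).toAdd := by
    apply φ.injective
    rw [map_zpow, MulEquiv.apply_symm_apply, ← ofAdd_zsmul]
    simp
  have key (v : V) (n : N) : (φ (MulAut.conjNormal v n)).toAdd =
      (φ (MulAut.conjNormal v τ)).toAdd * (φ n).toAdd := by
    conv_lhs => rw [hτ n]
    rw [map_zpow, map_zpow, toAdd_zpow, smul_eq_mul, mul_comm]
  let ε : V →* ℤ :=
    { toFun := fun v => (φ (MulAut.conjNormal v τ)).toAdd
      map_one' := by simp [τ]
      map_mul' := fun v w => by
        rw [map_mul, MulAut.mul_apply, key] }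
  refine ⟨ε, fun v => ?_, fun n => ?_, key⟩
  · refine Int.isUnit_iff.1 (IsUnit.of_mul_eq_one (ε v⁻¹) ?_)
    rw [← map_mul, mul_inv_cancel, map_one]
  · change (φ (MulAut.conjNormal (n : V) τ)).toAdd = 1
    have : MulAut.conjNormal (n : V) τ = τ := by
      ext
      rw [MulAut.conjNormal_apply]
      change ((n * τ * n⁻¹ : N) : V) = τ
      congr 1
      apply φ.injective
      rw [map_mul, map_mul, map_inv, mul_comm (φ n), mul_inv_cancel_right]
    rw [this]
    simp [τ]

/-- An infinite virtually cyclic group acts on the line by affine isometries with finite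
stabilizers. -/
theorem IsVirtuallyCyclic.exists_affine_cocycle [Infinite V] (h : IsVirtuallyCyclic V) :
    ∃ (ε : V →* ℤ) (f : V → ℤ) (N : Subgroup V), N.FiniteIndex ∧ (∀ v, ε v = 1 ∨ ε v = -1) ∧
      (∀ v w, f (v * w) = f v + ε v * f w) ∧ ∀ n ∈ N, ε n = 1 ∧ (f n = 0 → n = 1) := by
  obtain ⟨N, _, _, ⟨φ⟩⟩ := h.exists_normal_mulEquiv_int
  obtain ⟨ε, hε, hεN, hconj⟩ := exists_sign_of_normal_mulEquiv_int N φ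
  have : Fintype (V ⧸ N) := Fintype.ofFinite _
  have hout (x : V) : x * (x : V ⧸ N).out⁻¹ ∈ N := by
    rw [← QuotientGroup.eq_one_iff]
    simp
  -- This extends `φ` to `V` along a transversal, equivariantly for left translation by `N`.
  let θ (x : V) : ℤ := (φ ⟨x * (x : V ⧸ N).out⁻¹, hout x⟩).toAdd
  have hθ (n : N) (x : V) : θ (n * x) = (φ n).toAdd + θ x := by
    have : ((n * x : V) : V ⧸ N) = x := by
      rw [QuotientGroup.mk_mul, (QuotientGroup.eq_one_iff _).2 n.2, one_mul]
    change (φ _).toAdd = (φ _).toAdd + (φ _).toAdd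
    rw [← toAdd_mul, ← map_mul]
    congr 2
    ext
    simp [this, mul_assoc]
  let T (v : V) (x : V) : ℤ := ε x * (θ (x * v) - θ x)
  have hTq (v x y : V) (hxy : (x : V ⧸ N) = y) : T v x = T v y := by
    obtain ⟨n, rfl⟩ : ∃ n : N, n * y = x :=
      ⟨⟨x / y, (QuotientGroup.eq_iff_div_mem).1 hxy⟩, by simp⟩
    simp only [T]
    rw [mul_assoc, hθ, hθ, map_mul, hεN]
    ring
  have hTmul (v w x : V) : T (v * w) x = T v x + ε v * T w (x * v) := by
    have hsq : ε v * ε v = 1 := by rcases hε v with h | h <;> simp [h]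
    simp only [T]
    rw [map_mul, ← mul_assoc]
    linear_combination (-ε x * (θ (x * v * w) - θ (x * v))) * hsq
  have hTN (n : N) (x : V) : T n x = (φ n).toAdd := by
    have hsq : ε x * ε x = 1 := by rcases hε x with h | h <;> simp [h]
    have hx : x * n = (MulAut.conjNormal x n : N) * x := by simp
    simp only [T]
    rw [hx, hθ, hconj]
    linear_combination (φ n).toAdd * hsq
  -- The transfer of `φ`: the summand depends only on the coset, right translation permutes the
  -- cosets, and on `N` the sum is the index times `φ`.
  let f (v : V) : ℤ := ∑ q : V ⧸ N, T v q.out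
  refine ⟨ε, f, N, inferInstance, hε, fun v w => ?_, fun n hn => ⟨hεN ⟨n, hn⟩, fun h0 => ?_⟩⟩
  · have hshift : ∑ q : V ⧸ N, T w (q.out * v) = f w := by
      refine Fintype.sum_equiv (Equiv.mulRight (v : V ⧸ N)) _ _ fun q => hTq _ _ _ ?_
      simp
    simp only [f]
    rw [Finset.sum_congr rfl fun q _ => hTmul v w q.out, Finset.sum_add_distrib,
      ← Finset.mul_sum, hshift]
  · have hsum : f n = Fintype.card (V ⧸ N) * (φ ⟨n, hn⟩).toAdd := by
      simp only [f]
      rw [Finset.sum_congr rfl fun q _ => hTN ⟨n, hn⟩ q.out]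
      simp
    rw [hsum, mul_eq_zero] at h0
    rcases h0 with h0 | h0
    · exact absurd h0 (by simp)
    · have : φ ⟨n, hn⟩ = 1 := h0
      exact congrArg Subtype.val ((map_eq_one_iff φ φ.injective).1 this)

end AffineCocycle

/-! ### Virtually cyclic groups acting on the line. -/

section Line

theorem exists_int_antidifference {A : Type*} [AddCommGroup A] (g : ℤ → A) :
    ∃ p : ℤ → A, ∀ n, p (n + 1) - p n = g n := by
  refine ⟨fun n => ∑ i ∈ Finset.Ico 0 n, g i - ∑ i ∈ Finset.Ico n 0, g i, fun n => ?_⟩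
  rcases le_or_gt 0 n with hn | hn
  · have h₁ : Finset.Ico 0 (n + 1) = insert n (Finset.Ico 0 n) := by ext; simp; omega
    have h₂ : Finset.Ico n 0 = ∅ := by simp [hn]
    have h₃ : Finset.Ico (n + 1) 0 = ∅ := by simp; omega
    beta_reduce
    rw [h₁, h₂, h₃, Finset.sum_insert (by simp)]
    simp
  · have h₁ : Finset.Ico n 0 = insert n (Finset.Ico (n + 1) 0) := by ext; simp; omega
    have h₂ : Finset.Ico 0 n = ∅ := by simp [hn.le]
    have h₃ : Finset.Ico 0 (n + 1) = ∅ := by simp; omega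
    beta_reduce
    rw [h₁, h₂, h₃, Finset.sum_insert (by simp)]
    simp

variable {V : Type u} [Group V]

/-- The action on the even subdivision of the line given by a sign and a cocycle. -/
abbrev affineAction (ε : V →* ℤ) (f : V → ℤ) (hf : ∀ v w, f (v * w) = f v + ε v * f w) :
    MulAction V (ULift.{u} ℤ) where
  -- The factor `2` makes a reflection `x ↦ -x + 2 * f v` fix the vertex `f v` rather than possibly
  -- an edge midpoint, and makes signs `±1` preserve parity.
  smul v x := ⟨ε v * x.down + 2 * f v⟩
  one_smul x := by
    have h1 := hf 1 1
    rw [map_one, one_mul, one_mul] at h1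
    refine ULift.ext _ _ ?_
    change ε 1 * x.down + 2 * f 1 = x.down
    rw [map_one]
    omega
  mul_smul v w x := by
    refine ULift.ext _ _ ?_
    change ε (v * w) * x.down + 2 * f (v * w) =
      ε v * (ε w * x.down + 2 * f w) + 2 * f v
    rw [map_mul, hf]
    ring

/-- On powers of an element of sign `1` the cocycle is additive, and `ℤ` has no torsion: a
translation of finite order is trivial. -/
theorem affine_eq_zero_of_finite {ε : V →* ℤ} {f : V → ℤ}
    (hf : ∀ v w, f (v * w) = f v + ε v * f w) {L : Subgroup V} [Finite L] {l : V} (hl : l ∈ L)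
    (hε : ε l = 1) : f l = 0 := by
  have hpow (n : ℕ) : f (l ^ n) = n * f l := by
    induction n with
    | zero => simpa using hf 1 1
    | succ n ih =>
      rw [pow_succ, hf, ih, map_pow, hε]
      push_cast
      ring
  have h1 : f 1 = 0 := by simpa using hf 1 1
  obtain ⟨n, hn, hln⟩ := (isOfFinOrder_of_finite (⟨l, hl⟩ : L)).exists_pow_eq_one
  have hln' : l ^ n = 1 := congrArg Subtype.val hln
  have := hpow n
  rw [hln', h1, eq_comm, mul_eq_zero] at this
  rcases this with h | h
  · omega
  · exact h

theorem IsVirtuallyCyclic.cd_finiteFamily_le_one_of_infinite [Infinite V]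
    (h : IsVirtuallyCyclic V) : (finiteFamily V).cd ≤ ((1 : ℕ) : WithBot ℕ∞) := by
  obtain ⟨ε, f, N, hN, hε, hf, hfN⟩ := h.exists_affine_cocycle
  let _ : MulAction V (ULift.{u} ℤ) := affineAction ε f hf
  have hsmul (v : V) (x : ULift.{u} ℤ) : (v • x).down = ε v * x.down + 2 * f v := rfl
  -- Edges point from an even vertex to an odd neighbour, an orientation that reflections respect
  -- too.
  let E : Type u := {p : ULift.{u} ℤ × ULift.{u} ℤ //
    Even p.1.down ∧ (p.2.down = p.1.down + 1 ∨ p.2.down = p.1.down - 1)}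
  let _ : MulAction V E :=
    { smul := fun v e => ⟨v • e.1, by
        obtain ⟨⟨x, y⟩, ⟨k, hk⟩, hxy⟩ := e
        change Even (v • x).down ∧
          ((v • y).down = (v • x).down + 1 ∨ (v • y).down = (v • x).down - 1)
        rw [hsmul, hsmul, Int.even_iff]
        simp only at hk hxy
        rcases hε v with h | h <;> rw [h] <;> omega⟩
      one_smul := fun e => Subtype.ext (one_smul V e.1)
      mul_smul := fun v w e => Subtype.ext (mul_smul v w e.1) }
  let s : E →[V] ULift.{u} ℤ := ⟨fun e => e.1.1, fun v e => rfl⟩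
  let t : E →[V] ULift.{u} ℤ := ⟨fun e => e.1.2, fun v e => rfl⟩
  have hstab (x : ULift.{u} ℤ) : Finite (MulAction.stabilizer V x) := by
    -- Two stabilizing elements in one coset of `N` differ by a translation with a fixed point,
    -- which is trivial.
    refine Finite.of_injective
      (fun v : MulAction.stabilizer V x => ((v : V) : V ⧸ N)) fun v w hvw => ?_
    obtain ⟨h1, h0⟩ := hfN _ (QuotientGroup.eq.1 hvw)
    have hfix := congrArg ULift.down (v⁻¹ * w).2
    change (((v : V)⁻¹ * (w : V)) • x).down = x.down at hfix
    rw [hsmul, h1] at hfix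
    exact Subtype.ext (inv_mul_eq_one.1 (h0 (by omega)))
  have hstabE (e : E) : Finite (MulAction.stabilizer V e) := by
    have := hstab (s e)
    refine Finite.of_injective (Subgroup.inclusion (K := MulAction.stabilizer V (s e))
      fun v hv => ?_) (Subgroup.inclusion_injective _)
    have hv : v • e = e := hv
    change v • s e = s e
    rw [← map_smul, hv]
  have hdich (L : Subgroup V) (hL : Finite L) :
      (∀ x : ULift.{u} ℤ, ∀ l ∈ L, l • x = x) ∨
        ∃ c : ULift.{u} ℤ, ∀ x, (∀ l ∈ L, l • x = x) ↔ x = c := by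
    by_cases hall : ∀ l ∈ L, ε l = 1
    · refine Or.inl fun x l hl => ULift.ext _ _ ?_
      rw [hsmul, hall l hl, affine_eq_zero_of_finite hf hl (hall l hl)]
      ring
    · push Not at hall
      obtain ⟨l, hl, hl1⟩ := hall
      have hεl : ε l = -1 := (hε l).resolve_left hl1
      refine Or.inr ⟨⟨f l⟩, fun x => ⟨fun hx => ULift.ext _ _ ?_, ?_⟩⟩
      · have := congrArg ULift.down (hx l hl)
        rw [hsmul, hεl] at this
        change x.down = f l
        omega
      · rintro rfl m hm
        refine ULift.ext _ _ ?_
        rw [hsmul]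
        change ε m * f l + 2 * f m = f l
        rcases hε m with h | h
        · rw [h, affine_eq_zero_of_finite hf hm h]
          ring
        -- A product of two reflections in `L` is a translation of finite order, so both have the
        -- same centre.
        · have hml := affine_eq_zero_of_finite hf (L.mul_mem hm hl)
            (by rw [map_mul, h, hεl]; norm_num)
          rw [hf, h] at hml
          rw [h]
          omega
  have hEfix (L : Subgroup V) (c : ULift.{u} ℤ) (hc : ∀ x, (∀ l ∈ L, l • x = x) ↔ x = c) (e : E) :
      ¬ ∀ l ∈ L, l • e = e := by
    intro he
    have hs := (hc (s e)).1 fun l hl => by rw [← map_smul, he l hl]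
    have ht := (hc (t e)).1 fun l hl => by rw [← map_smul, he l hl]
    have hst : (s e).down = (t e).down := by rw [hs, ht]
    have h2 : (t e).down = (s e).down + 1 ∨ (t e).down = (s e).down - 1 := e.2.2
    omega
  refine SubgroupFamily.cd_le_one_of_tree (finiteFamily V) s t hstab hstabE
    (fun L hL => ?_) (fun L hL A _ g => ?_) (fun L hL A q hq v w hv hw => ?_)
  · rcases hdich L hL with h | ⟨c, hc⟩
    · exact ⟨⟨0⟩, h _⟩
    · exact ⟨c, (hc c).2 rfl⟩
  · rcases hdich L hL with h | ⟨c, hc⟩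
    -- The line is read from left to right; the edge between an odd `n` and `n + 1` points the other
    -- way, hence the sign.
    · let r (n : ℤ) : A :=
        if hn : Even n then g ⟨(⟨n⟩, ⟨n + 1⟩), hn, Or.inl rfl⟩
        else - g ⟨(⟨n + 1⟩, ⟨n⟩), (Int.not_even_iff_odd.1 hn).add_one, Or.inr (by simp)⟩
      obtain ⟨p, hp⟩ := exists_int_antidifference r
      refine ⟨fun x => p x.down, fun e _ => ?_⟩
      obtain ⟨⟨⟨x⟩, ⟨y⟩⟩, hx, hxy⟩ := e
      change p y - p x = _
      simp only at hx hxy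
      rcases hxy with rfl | rfl
      · rw [hp]
        exact dif_pos hx
      · have hodd : ¬ Even (x - 1) := by
          rw [Int.not_even_iff_odd]
          exact hx.sub_odd odd_one
        have := hp (x - 1)
        simp only [r, dif_neg hodd, sub_add_cancel] at this
        rw [← neg_sub, this, neg_neg]
    · exact ⟨0, fun e he => absurd he (hEfix L c hc e)⟩
  · rcases hdich L hL with h | ⟨c, hc⟩
    · have hstep (n : ℤ) : q ⟨n + 1⟩ = q ⟨n⟩ := by
        by_cases hn : Even n
        · exact hq ⟨(⟨n⟩, ⟨n + 1⟩), hn, Or.inl rfl⟩ fun l hl =>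
            Subtype.ext (Prod.ext (h _ l hl) (h _ l hl))
        · exact (hq ⟨(⟨n + 1⟩, ⟨n⟩), (Int.not_even_iff_odd.1 hn).add_one, Or.inr (by simp)⟩
            fun l hl => Subtype.ext (Prod.ext (h _ l hl) (h _ l hl))).symm
      have hconst (n : ℤ) : q ⟨n⟩ = q ⟨0⟩ := by
        induction n with
        | zero => rfl
        | succ n ih => rw [hstep, ih]
        | pred n ih => rw [← ih, ← hstep, sub_add_cancel]
      exact (hconst v.down).trans (hconst w.down).symm
    · rw [(hc v).1 hv, (hc w).1 hw]

/-- The tree is a single vertex without edges; its stabilizer is the whole finite group. -/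
theorem cd_finiteFamily_le_one_of_finite [Finite V] :
    (finiteFamily V).cd ≤ ((1 : ℕ) : WithBot ℕ∞) := by
  let _ : MulAction V PEmpty.{u + 1} :=
    { smul := fun _ e => e, one_smul := fun _ => rfl, mul_smul := fun _ _ _ => rfl }
  exact SubgroupFamily.cd_le_one_of_tree (finiteFamily V) (V := PUnit) (E := PEmpty)
    ⟨PEmpty.elim, fun _ e => e.elim⟩ ⟨PEmpty.elim, fun _ e => e.elim⟩
    (fun _ => inferInstanceAs (Finite _)) (fun e => e.elim) (fun _ _ => ⟨⟨⟩, fun _ _ => rfl⟩)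
    (fun _ _ _ _ _ => ⟨0, fun e => e.elim⟩) (fun _ _ _ _ _ _ _ _ _ => rfl)

theorem IsVirtuallyCyclic.cd_finiteFamily_le_one (h : IsVirtuallyCyclic V) :
    (finiteFamily V).cd ≤ ((1 : ℕ) : WithBot ℕ∞) := by
  cases finite_or_infinite V
  · exact cd_finiteFamily_le_one_of_finite
  · exact h.cd_finiteFamily_le_one_of_infinite

end Line

theorem finiteFamily_inter {G : Type u} [Group G] (H : Subgroup G) :
    (finiteFamily G).inter H = finiteFamily H := by
  ext L
  constructor
  · rintro ⟨K, hK, rfl⟩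
    have : Finite K := hK
    exact Finite.of_injective (fun x : K.subgroupOf H => (⟨x.1.1, x.2⟩ : K)) fun x y hxy =>
      Subtype.ext (Subtype.ext (congrArg (Subtype.val : K → G) hxy))
  · intro hL
    have : Finite L := hL
    refine ⟨L.map H.subtype, Finite.of_equiv L
      (L.equivMapOfInjective _ H.subtype_injective).toEquiv, ?_⟩
    exact (Subgroup.comap_map_eq_self_of_injective H.subtype_injective L).symm

theorem finiteFamily_subset_virtuallyCyclicFamily (G : Type u) [Group G] :
    (finiteFamily G).carrier ⊆ (virtuallyCyclicFamily G).carrier := by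
  intro H hH
  have : Finite H := hH
  exact ⟨⊥, inferInstance, inferInstance⟩

theorem corollary4p2 (G : Type u) [Group G] :
    (∀ F F' : SubgroupFamily G, F.carrier ⊆ F'.carrier →
      ∀ d : ℕ, (∀ H ∈ F'.carrier, (F.inter H).cd ≤ (d : WithBot ℕ∞)) →
        F.cd ≤ F'.cd + (d : WithBot ℕ∞)) ∧
    (finiteFamily G).cd ≤ (virtuallyCyclicFamily G).cd + 1 := by
  refine ⟨fun F F' h d hd => SubgroupFamily.cd_le_cd_add h d hd, ?_⟩
  have := SubgroupFamily.cd_le_cd_add (finiteFamily_subset_virtuallyCyclicFamily G) 1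
    fun H hH => by
      rw [finiteFamily_inter]
      exact IsVirtuallyCyclic.cd_finiteFamily_le_one hH
  rwa [Nat.cast_one] at this
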